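/- Let $\mathbb D=\{z\in\mathbb C:|z|<1\}$ and let $dA=dx\,dy/\pi$ be the normalized area measure on $\mathbb D$. A radial weight is a nonnegative function $\omega\in L^1(\mathbb D,dA)$ with $\omega(z)=\omega(|z|)$ and $\widehat\omega(r)=\int_r^1\omega(s)\,ds>0$ for all $0\le r<1$; it belongs to $\widehat{\mathcal D}$ if there is $C>0$ such that $\widehat\omega(r)\le C\,\widehat\omega\left(\frac{1+r}2\right)$ for all $0\le r<1$. The weighted Bergman space $A^2_\omega$ is the Hilbert space of analytic functions $f$ on $\mathbb D$ with $\|f\|_{A^2_\omega}^2=\int_{\mathbb D}|f|^2\omega\,dA<\infty$; $B^\omega_z$ ($z\in\mathbb D$) denotes its reproducing kernel and $b^\omega_z=B^\omega_z/\|B^\omega_z\|_{A^2_\omega}$. The Berezin transform of a bounded operator $T$ on $A^2_\omega$ is $\widetilde T(z)=\langle T b^\omega_z,b^\omega_z\rangle_{A^2_\omega}$, the Toeplitz operator of a positive Borel measure $\mu$ on $\mathbb D$ is $\mathcal T_\mu(f)(z)=\int_{\mathbb D}f(\zeta)\overline{B^\omega_z(\zeta)}\,d\mu(\zeta)$, and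 $\mathcal S_1(A^2_\omega)$ is the trace class: the compact operators on $A^2_\omega$ whose singular values $\lambda_n(T)=\inf\{\|T-R\|:\operatorname{rank}R\le n\}$, $n\ge 0$, are summable. **Proposition.** There exist $\omega\in\widehat{\mathcal D}$ and a positive Borel measure $\mu$ on $\mathbb D$ such that $\mathcal T_\mu\in\mathcal S_1(A^2_\omega)$ and $$\widetilde{\mathcal T}_\mu\notin L^1\left(\mathbb D,\frac{dA(z)}{(1-|z|)^2}\right).$$ Consequently, in the theorem that, for every $\omega\in\widehat{\mathcal D}$, a positive operator $T$ on $A^2_\omega$ is in $\mathcal S_1(A^2_\omega)$ if and only if $\widetilde T\in L^1(\mathbb D,\frac{\omega}{\omega^\star}dA)$, where $\omega^\star(z)=\int_{|z|}^1\omega(s)\log\frac{s}{|z|}\,s\,ds$, one may not replace $L^1(\mathbb D,\frac{\omega}{\omega^\star}dA)$ by $L^1(\mathbb D,\frac{dA(z)}{(1-|z|)^2})$: it is not true that for every $\omega\in\widehat{\mathcal D}$ and every positive operator $T$ on $A^2_\omega$ one has $T\in\mathcal S_1(A^2_\omega)$ if and only if $\widetilde T\in L^1(\mathbb D,\frac{dA(z)}{(1-|z|)^2})$.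 -/

import Mathlib

namespace DoublingBergman

open MeasureTheory Metric Set Filter Topology
open scoped ENNReal NNReal ComplexConjugate

noncomputable section

/-- The open unit disc, as a type. -/
abbrev Disc : Type := ball (0 : ℂ) 1

/-- Normalized area measure `dx dy / π` on the disc. -/
def area : Measure Disc :=
  ENNReal.ofReal (Real.pi⁻¹) • (volume : Measure ℂ).comap Subtype.val

/-- A radial weight on the disc, `z ↦ toFun |z|`: a measurable nonnegative function that is
integrable with respect to area. As usual it is assumed not to vanish almost everywhere near the
boundary (otherwise `A²_ω` would contain all analytic functions). -/
structure RadialWeight where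
  toFun : ℝ → ℝ
  measurable_toFun : Measurable toFun
  nonneg : ∀ r, 0 ≤ r → r < 1 → 0 ≤ toFun r
  integrable : Integrable (fun z : Disc => toFun ‖(z : ℂ)‖) area
  tail_pos : ∀ r, 0 ≤ r → r < 1 → 0 < ∫⁻ s in Ioo r 1, ENNReal.ofReal (toFun s)

namespace RadialWeight

/-- `ω̂(r) = ∫_r^1 ω(s) ds`. -/
def tail (ω : RadialWeight) (r : ℝ) : ℝ≥0∞ := ∫⁻ s in Ioo r 1, ENNReal.ofReal (ω.toFun s)

/-- The doubling class `D̂`. By the condition at `r = 0` the integrals `ω̂(r)` are finite: `ω̂(1/2)`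
is finite because `ω` is integrable on the disc. -/
def IsDoubling (ω : RadialWeight) : Prop :=
  ∃ C : ℝ≥0, ∀ r : ℝ, 0 ≤ r → r < 1 → ω.tail r ≤ C * ω.tail ((1 + r) / 2)

/-- The measure `ω dA` on the disc. -/
def measure (ω : RadialWeight) : Measure Disc :=
  area.withDensity (fun z => ENNReal.ofReal (ω.toFun ‖(z : ℂ)‖))

end RadialWeight

lemma enorm_sq_le_circle {F : ℂ → ℂ} (hF : DifferentiableOn ℂ F (ball 0 1)) {r ρ : ℝ}
    (h0 : 0 ≤ r) (hr : r < 1)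
    (hρ : (1 + r) / 2 < ρ) (hρ1 : ρ < 1) {z : ℂ} (hz : ‖z‖ ≤ r) :
    ‖F z‖ₑ ^ 2 ≤ ENNReal.ofReal (1 / (Real.pi * (1 - r))) *
      ∫⁻ θ in Ioo (-Real.pi) Real.pi, ‖F (Complex.polarCoord.symm (ρ, θ))‖ₑ ^ 2 := by
  have hρ0 : 0 < ρ := by linarith
  have hcb : closedBall (0 : ℂ) ρ ⊆ ball 0 1 := closedBall_subset_ball hρ1
  have hd : DiffContOnCl ℂ (fun w => F w ^ 2) (ball 0 |ρ|) := by
    rw [abs_of_pos hρ0]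
    have : DifferentiableOn ℂ (fun w => F w ^ 2) (closedBall 0 ρ) := (hF.mono hcb).pow 2
    exact this.diffContOnCl_ball subset_rfl
  have hzb : z ∈ ball (0 : ℂ) |ρ| := by
    rw [abs_of_pos hρ0, mem_ball_zero_iff]; linarith
  have key := hd.circleAverage_smul_div hzb
  rw [Real.circleAverage_eq_integral_add (-Real.pi),
    intervalIntegral.integral_comp_add_right
      (fun θ => (fun w => ((w - 0) / (w - z)) • F w ^ 2) (circleMap 0 ρ θ))] at key
  have e1 : (0 : ℝ) + -Real.pi = -Real.pi := by ring
  have e2 : 2 * Real.pi + -Real.pi = Real.pi := by ring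
  rw [e1, e2, intervalIntegral.integral_of_le (by linarith [Real.pi_pos]),
    integral_Ioc_eq_integral_Ioo] at key
  have hpt : ∀ θ : ℝ, circleMap 0 ρ θ = Complex.polarCoord.symm (ρ, θ) := by
    intro θ
    simp [circleMap, Complex.exp_mul_I]
  have hn : ‖F z‖ₑ ^ 2 = ‖F z ^ 2‖ₑ := by rw [enorm_pow]
  rw [hn, ← key, enorm_smul]
  have hπ := Real.pi_pos
  calc ‖(2 * Real.pi)⁻¹‖ₑ * ‖∫ θ in Ioo (-Real.pi) Real.pi,
          (fun w => ((w - 0) / (w - z)) • F w ^ 2) (circleMap 0 ρ θ)‖ₑ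
      ≤ ‖(2 * Real.pi)⁻¹‖ₑ * ∫⁻ θ in Ioo (-Real.pi) Real.pi,
          ENNReal.ofReal (2 / (1 - r)) * ‖F (Complex.polarCoord.symm (ρ, θ))‖ₑ ^ 2 := by
        gcongr
        refine (enorm_integral_le_lintegral_enorm _).trans (lintegral_mono fun θ => ?_)
        simp only [sub_zero, enorm_smul, enorm_pow]
        rw [← hpt]
        gcongr
        rw [← ofReal_norm]
        apply ENNReal.ofReal_le_ofReal
        rw [norm_div]
        have h1 : ‖circleMap 0 ρ θ‖ = ρ := by simp [abs_of_pos hρ0]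
        have h2 : ρ - r ≤ ‖circleMap 0 ρ θ - z‖ := by
          have := norm_sub_norm_le (circleMap 0 ρ θ) z
          linarith
        rw [h1, div_le_div_iff₀ (by linarith) (by linarith)]
        nlinarith
    _ = _ := by
        rw [lintegral_const_mul' _ _ ENNReal.ofReal_ne_top, ← mul_assoc]
        congr 1
        rw [← ofReal_norm, ← ENNReal.ofReal_mul (norm_nonneg _)]
        congr 1
        rw [Real.norm_of_nonneg (by positivity)]
        have : 1 - r ≠ 0 := by linarith
        field_simp

namespace RadialWeight

lemma lintegral_measure (ω : RadialWeight) {F : ℂ → ℂ} (hF : DifferentiableOn ℂ F (ball 0 1))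
    {s : ℝ} (hs : 0 ≤ s) :
    ∫⁻ ρ in Ioo s 1, ENNReal.ofReal (ω.toFun ρ) * (ENNReal.ofReal (Real.pi⁻¹ * s) *
      ∫⁻ θ in Ioo (-Real.pi) Real.pi, ‖F (Complex.polarCoord.symm (ρ, θ))‖ₑ ^ 2) ≤
    ∫⁻ z : Disc, ‖F z‖ₑ ^ 2 ∂ω.measure := by
  classical
  set G : ℂ → ℂ := (ball (0 : ℂ) 1).piecewise F 0 with hG
  have hGm : Measurable G := by
    apply ContinuousOn.measurable_piecewise hF.continuousOn continuousOn_const measurableSet_ball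
  set g : ℂ → ℝ≥0∞ := (ball (0 : ℂ) 1).indicator
    (fun z => ENNReal.ofReal (ω.toFun ‖z‖) * ‖G z‖ₑ ^ 2) with hg
  have hωm := ω.measurable_toFun
  have hgm : Measurable g := by
    apply Measurable.indicator _ measurableSet_ball
    fun_prop
  have hL : ∫⁻ z : Disc, ‖F z‖ₑ ^ 2 ∂ω.measure
      = ENNReal.ofReal Real.pi⁻¹ * ∫⁻ z, g z := by
    have h1 : ∀ z : Disc, F z = G z := fun z => by simp [hG, z.2]
    simp_rw [h1]
    rw [measure, lintegral_withDensity_eq_lintegral_mul _ (by fun_prop) (by fun_prop), area,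
      lintegral_smul_measure, smul_eq_mul]
    congr 1
    rw [hg, lintegral_indicator measurableSet_ball]
    exact lintegral_subtype_comap measurableSet_ball
      (fun z => ENNReal.ofReal (ω.toFun ‖z‖) * ‖G z‖ₑ ^ 2)
  rw [hL, ← Complex.lintegral_comp_polarCoord_symm, polarCoord_target,
    Measure.volume_eq_prod, ← Measure.prod_restrict, lintegral_prod]
  rotate_left
  · apply Measurable.aemeasurable
    have : Measurable (fun p : ℝ × ℝ => Complex.polarCoord.symm p) := by
      simp only [Complex.polarCoord_symm_apply]; fun_prop
    exact (by fun_prop : Measurable fun p : ℝ × ℝ => ENNReal.ofReal p.1).smul (hgm.comp this)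
  rw [← lintegral_const_mul' _ _ ENNReal.ofReal_ne_top]
  calc _ ≤ ∫⁻ x in Ioo s 1, ENNReal.ofReal Real.pi⁻¹ * ∫⁻ y in Ioo (-Real.pi) Real.pi,
        ENNReal.ofReal x • g (Complex.polarCoord.symm (x, y)) := by
        apply setLIntegral_mono' measurableSet_Ioo
        rintro ρ ⟨h1, h2⟩
        have hρ0 : 0 < ρ := by linarith
        have hval : ∀ θ : ℝ, g (Complex.polarCoord.symm (ρ, θ)) = ENNReal.ofReal (ω.toFun ρ) *
            ‖F (Complex.polarCoord.symm (ρ, θ))‖ₑ ^ 2 := by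
          intro θ
          have hn : ‖Complex.polarCoord.symm (ρ, θ)‖ = ρ := by
            rw [Complex.norm_polarCoord_symm, abs_of_pos hρ0]
          have hm : Complex.polarCoord.symm (ρ, θ) ∈ ball (0 : ℂ) 1 := by
            rw [mem_ball_zero_iff, hn]; exact h2
          rw [hg, indicator_of_mem hm, hn, hG, Set.piecewise_eq_of_mem _ _ _ hm]
        simp_rw [hval, smul_eq_mul]
        rw [lintegral_const_mul' _ _ ENNReal.ofReal_ne_top,
          lintegral_const_mul' _ _ ENNReal.ofReal_ne_top,
          ENNReal.ofReal_mul (by positivity)]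
        have : ENNReal.ofReal s ≤ ENNReal.ofReal ρ := ENNReal.ofReal_le_ofReal h1.le
        calc _ = ENNReal.ofReal Real.pi⁻¹ * (ENNReal.ofReal s * (ENNReal.ofReal (ω.toFun ρ) *
            ∫⁻ θ in Ioo (-Real.pi) Real.pi, ‖F (Complex.polarCoord.symm (ρ, θ))‖ₑ ^ 2)) := by ring
          _ ≤ _ := by gcongr
    _ ≤ _ := lintegral_mono_set fun x hx => lt_of_le_of_lt hs hx.1

/-- Point evaluations of analytic functions are bounded in the weighted `L²` norm, locally
uniformly on the disc. -/
lemma exists_bound (ω : RadialWeight) {r : ℝ} (h0 : 0 ≤ r) (hr : r < 1) :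
    ∃ C : ℝ≥0, ∀ F : ℂ → ℂ, DifferentiableOn ℂ F (ball 0 1) → ∀ z : ℂ, ‖z‖ ≤ r →
      ‖F z‖ₑ ^ 2 ≤ C * ∫⁻ w : Disc, ‖F w‖ₑ ^ 2 ∂ω.measure := by
  set s := (1 + r) / 2 with hs
  have hs0 : 0 < s := by rw [hs]; linarith
  have hs1 : s < 1 := by rw [hs]; linarith
  have hA := ω.tail_pos s hs0.le hs1
  set A := ∫⁻ ρ in Ioo s 1, ENNReal.ofReal (ω.toFun ρ) with hAdef
  set K := ENNReal.ofReal (1 / (Real.pi * (1 - r))) with hK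
  set c := ENNReal.ofReal (Real.pi⁻¹ * s) with hc
  have hc0 : c ≠ 0 := by
    rw [hc]; simp only [ne_eq, ENNReal.ofReal_eq_zero, not_le]; have := Real.pi_pos; positivity
  have hct : c ≠ ⊤ := ENNReal.ofReal_ne_top
  have hKt : K ≠ ⊤ := ENNReal.ofReal_ne_top
  have main : ∀ F : ℂ → ℂ, DifferentiableOn ℂ F (ball 0 1) → ∀ z : ℂ, ‖z‖ ≤ r →
      ‖F z‖ₑ ^ 2 * A ≤ K / c * ∫⁻ w : Disc, ‖F w‖ₑ ^ 2 ∂ω.measure := by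
    intro F hF z hz
    calc ‖F z‖ₑ ^ 2 * A = ∫⁻ ρ in Ioo s 1, ‖F z‖ₑ ^ 2 * ENNReal.ofReal (ω.toFun ρ) := by
          rw [lintegral_const_mul' _ _ (by finiteness)]
      _ ≤ ∫⁻ ρ in Ioo s 1, K / c * (ENNReal.ofReal (ω.toFun ρ) * (c *
          ∫⁻ θ in Ioo (-Real.pi) Real.pi, ‖F (Complex.polarCoord.symm (ρ, θ))‖ₑ ^ 2)) := by
          apply setLIntegral_mono' measurableSet_Ioo
          rintro ρ ⟨h1, h2⟩
          have := enorm_sq_le_circle hF h0 hr h1 h2 hz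
          calc _ ≤ (K * ∫⁻ θ in Ioo (-Real.pi) Real.pi,
                ‖F (Complex.polarCoord.symm (ρ, θ))‖ₑ ^ 2) * ENNReal.ofReal (ω.toFun ρ) := by
                gcongr
            _ = (K / c * c) * ((∫⁻ θ in Ioo (-Real.pi) Real.pi,
                ‖F (Complex.polarCoord.symm (ρ, θ))‖ₑ ^ 2) * ENNReal.ofReal (ω.toFun ρ)) := by
                rw [ENNReal.div_mul_cancel hc0 hct, mul_assoc]
            _ = _ := by ring
      _ = K / c * ∫⁻ ρ in Ioo s 1, (ENNReal.ofReal (ω.toFun ρ) * (c *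
          ∫⁻ θ in Ioo (-Real.pi) Real.pi, ‖F (Complex.polarCoord.symm (ρ, θ))‖ₑ ^ 2)) := by
          rw [lintegral_const_mul' _ _ (ENNReal.div_ne_top hKt hc0)]
      _ ≤ _ := by gcongr; exact ω.lintegral_measure hF hs0.le
  have hKc : K / c ≠ ⊤ := ENNReal.div_ne_top hKt hc0
  rcases eq_or_ne A ⊤ with hAt | hAt
  · refine ⟨1, fun F hF z hz => ?_⟩
    have h := main F hF z hz
    rw [hAt] at h
    rcases eq_or_ne (‖F z‖ₑ ^ 2) 0 with h0 | h0
    · rw [h0]; exact zero_le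
    · rw [ENNReal.mul_top h0, top_le_iff, ENNReal.mul_eq_top] at h
      rcases h with h | h
      · rw [h.2]; simp
      · exact absurd h.1 hKc
  · refine ⟨(K / c / A).toNNReal, fun F hF z hz => ?_⟩
    rw [ENNReal.coe_toNNReal (ENNReal.div_ne_top hKc hA.ne')]
    have h := main F hF z hz
    rw [← ENNReal.le_div_iff_mul_le (Or.inl hA.ne') (Or.inl hAt)] at h
    refine h.trans (le_of_eq ?_)
    simp only [div_eq_mul_inv]; ring


end RadialWeight

/-- The weighted Bergman space `A²_ω`: the subspace of those elements of `L²(ω dA)` that have an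
analytic representative on the disc. -/
def bergmanSpace (ω : RadialWeight) : Submodule ℂ (Lp ℂ 2 ω.measure) where
  carrier := {f | ∃ F : ℂ → ℂ, DifferentiableOn ℂ F (ball 0 1) ∧
    f =ᵐ[ω.measure] fun z : Disc => F z}
  zero_mem' := ⟨0, differentiableOn_const 0, Lp.coeFn_zero _ _ _⟩
  add_mem' := by
    rintro f g ⟨F, hF, hf⟩ ⟨G, hG, hg⟩
    exact ⟨F + G, hF.add hG, (Lp.coeFn_add f g).trans (hf.add hg)⟩
  smul_mem' := by
    rintro c f ⟨F, hF, hf⟩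
    exact ⟨c • F, hF.const_smul c, (Lp.coeFn_smul c f).trans (hf.const_smul c)⟩

namespace bergmanSpace

variable {ω : RadialWeight}

lemma lintegral_eq (f : Lp ℂ 2 ω.measure) {F : ℂ → ℂ} (h : f =ᵐ[ω.measure] fun z : Disc => F z) :
    ∫⁻ w : Disc, ‖F w‖ₑ ^ 2 ∂ω.measure = ‖f‖ₑ ^ 2 := by
  have h2 := eLpNorm_nnreal_pow_eq_lintegral (f := f) (μ := ω.measure) (p := 2) (by norm_num)
  have h3 : ∫⁻ w : Disc, ‖F w‖ₑ ^ 2 ∂ω.measure = ∫⁻ w : Disc, ‖f w‖ₑ ^ 2 ∂ω.measure :=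
    lintegral_congr_ae (h.mono fun z hz => by simp [hz])
  rw [h3, Lp.enorm_def]
  simpa using h2.symm

lemma exists_bound_norm (ω : RadialWeight) {r : ℝ} (h0 : 0 ≤ r) (hr : r < 1) :
    ∃ C : ℝ, ∀ (f : Lp ℂ 2 ω.measure) (F : ℂ → ℂ), DifferentiableOn ℂ F (ball 0 1) →
      (f =ᵐ[ω.measure] fun z : Disc => F z) → ∀ z : ℂ, ‖z‖ ≤ r → ‖F z‖ ≤ C * ‖f‖ := by
  obtain ⟨C, hC⟩ := ω.exists_bound h0 hr
  refine ⟨Real.sqrt C, fun f F hF h z hz => ?_⟩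
  have := hC F hF z hz
  rw [lintegral_eq f h] at this
  have h2 : ‖F z‖ ^ 2 ≤ C * ‖f‖ ^ 2 := by
    have h3 := ENNReal.toReal_mono (by finiteness) this
    simpa using h3
  rw [← Real.sqrt_sq (norm_nonneg (F z)), ← Real.sqrt_sq (norm_nonneg f),
    ← Real.sqrt_mul (by positivity)]
  exact Real.sqrt_le_sqrt h2

/-- The analytic representative of an element of `A²_ω`. -/
def rep (f : bergmanSpace ω) : ℂ → ℂ := f.2.choose

lemma differentiableOn_rep (f : bergmanSpace ω) : DifferentiableOn ℂ (rep f) (ball 0 1) :=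
  f.2.choose_spec.1

lemma ae_eq_rep (f : bergmanSpace ω) :
    (f : Lp ℂ 2 ω.measure) =ᵐ[ω.measure] fun z : Disc => rep f z :=
  f.2.choose_spec.2

/-- The analytic representative is unique on the disc. -/
lemma rep_eq (f : bergmanSpace ω) {F : ℂ → ℂ} (hF : DifferentiableOn ℂ F (ball 0 1))
    (h : (f : Lp ℂ 2 ω.measure) =ᵐ[ω.measure] fun z : Disc => F z) (z : Disc) :
    rep f z = F z := by
  obtain ⟨C, hC⟩ := exists_bound_norm ω (norm_nonneg (z : ℂ)) (mem_ball_zero_iff.1 z.2)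
  have hd : DifferentiableOn ℂ (rep f - F) (ball 0 1) := (differentiableOn_rep f).sub hF
  have := hC 0 _ hd (by
    filter_upwards [ae_eq_rep f, h, Lp.coeFn_zero ℂ 2 ω.measure] with w h1 h2 h3
    rw [h3]
    simp [← h1, ← h2]) z le_rfl
  simp only [norm_zero, mul_zero, norm_le_zero_iff, Pi.sub_apply] at this
  exact sub_eq_zero.1 this

/-- Evaluation at a point of the disc. -/
def evalLM (z : Disc) : bergmanSpace ω →ₗ[ℂ] ℂ where
  toFun f := rep f z
  map_add' f g := rep_eq (f + g) ((differentiableOn_rep f).add (differentiableOn_rep g))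
    ((Lp.coeFn_add _ _).trans ((ae_eq_rep f).add (ae_eq_rep g))) z
  map_smul' c f := rep_eq (c • f) ((differentiableOn_rep f).const_smul c)
    ((Lp.coeFn_smul _ _).trans ((ae_eq_rep f).const_smul c)) z

/-- Evaluation at a point of the disc, as a bounded functional. -/
def evalCLM (z : Disc) : bergmanSpace ω →L[ℂ] ℂ :=
  (evalLM z).mkContinuousOfExistsBound (by
    obtain ⟨C, hC⟩ := exists_bound_norm ω (norm_nonneg (z : ℂ)) (mem_ball_zero_iff.1 z.2)
    exact ⟨C, fun f => hC f _ (differentiableOn_rep f) (ae_eq_rep f) z le_rfl⟩)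

/-- `A²_ω` as a space of functions on the disc: `f z` is the value at `z` of the analytic
function represented by `f`. -/
instance : RKHS ℂ (bergmanSpace ω) Disc ℂ where
  coeCLM := ContinuousLinearMap.pi evalCLM
  coeCLM_injective f g h := by
    have h' : ∀ z : Disc, rep f z = rep g z := fun z => congrFun h z
    apply Subtype.ext
    apply Lp.ext
    filter_upwards [ae_eq_rep f, ae_eq_rep g] with z h1 h2
    rw [h1, h2, h']

lemma coe_apply (f : bergmanSpace ω) (z : Disc) : f z = rep f z := rfl

instance : CompleteSpace (bergmanSpace ω) := by
  suffices h : IsClosed (bergmanSpace ω : Set (Lp ℂ 2 ω.measure)) from h.completeSpace_coe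
  apply IsSeqClosed.isClosed
  intro f g hf hfg
  choose F hF hfF using hf
  have hcauchy : ∀ r : ℝ, 0 ≤ r → r < 1 → UniformCauchySeqOn F atTop (closedBall 0 r) := by
    intro r h0 h1
    obtain ⟨C, hC⟩ := exists_bound_norm ω h0 h1
    rw [Metric.uniformCauchySeqOn_iff]
    intro ε hε
    have hcs := hfg.cauchySeq
    rw [Metric.cauchySeq_iff] at hcs
    obtain ⟨N, hN⟩ := hcs (ε / (|C| + 1)) (by positivity)
    refine ⟨N, fun m hm n hn z hz => ?_⟩
    have hz' : ‖z‖ ≤ r := by simpa using hz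
    have hb := hC (f m - f n) (F m - F n) ((hF m).sub (hF n))
      ((Lp.coeFn_sub _ _).trans ((hfF m).sub (hfF n))) z hz'
    have hd := hN m hm n hn
    rw [dist_eq_norm] at hd
    rw [dist_eq_norm]
    calc _ ≤ C * ‖f m - f n‖ := hb
      _ ≤ (|C| + 1) * ‖f m - f n‖ := by gcongr; linarith [le_abs_self C]
      _ < (|C| + 1) * (ε / (|C| + 1)) := by gcongr
      _ = ε := by field_simp
  have hlim : ∀ z : ℂ, ∃ w : ℂ, z ∈ ball (0 : ℂ) 1 → Tendsto (fun n => F n z) atTop (𝓝 w) := by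
    intro z
    by_cases hz : z ∈ ball (0 : ℂ) 1
    · have := (hcauchy ‖z‖ (norm_nonneg _) (mem_ball_zero_iff.1 hz)).cauchySeq
        (x := z) (by simp)
      obtain ⟨w, hw⟩ := cauchySeq_tendsto_of_complete this
      exact ⟨w, fun _ => hw⟩
    · exact ⟨0, fun h => absurd h hz⟩
  choose G hG using hlim
  have hloc : TendstoLocallyUniformlyOn F G atTop (ball 0 1) := by
    rw [tendstoLocallyUniformlyOn_iff_forall_isCompact isOpen_ball]
    intro K hK hKc
    rcases K.eq_empty_or_nonempty with rfl | hne
    · simp [TendstoUniformlyOn]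
    obtain ⟨x, hx, hmax⟩ := hKc.exists_isMaxOn hne continuous_norm.continuousOn
    have hx1 : ‖x‖ < 1 := mem_ball_zero_iff.1 (hK hx)
    have hu := (hcauchy ‖x‖ (norm_nonneg _) hx1).mono
      (fun y hy => by simpa using hmax hy : K ⊆ closedBall 0 ‖x‖)
    exact hu.tendstoUniformlyOn_of_tendsto fun y hy => hG y (hK hy)
  refine ⟨G, hloc.differentiableOn (Eventually.of_forall hF) isOpen_ball, ?_⟩
  obtain ⟨ns, hns, hae⟩ := (tendstoInMeasure_of_tendsto_Lp hfg).exists_seq_tendsto_ae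
  filter_upwards [hae, ae_all_iff.2 hfF] with z h1 h2
  refine tendsto_nhds_unique h1 ?_
  simp_rw [h2]
  exact (hG z z.2).comp hns.tendsto_atTop

end bergmanSpace

/-- The reproducing kernel `B_z` of `A²_ω`: `f z = ⟨f, B_z⟩` for every `f` in `A²_ω`. -/
def kernel (ω : RadialWeight) (z : Disc) : bergmanSpace ω := RKHS.kerFun (bergmanSpace ω) z 1

lemma inner_kernel (ω : RadialWeight) (z : Disc) (f : bergmanSpace ω) :
    inner ℂ (kernel ω z) f = f z := by
  simp [kernel]

/-- The normalized reproducing kernel `b_z = B_z / ‖B_z‖`. -/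
def normalizedKernel (ω : RadialWeight) (z : Disc) : bergmanSpace ω :=
  ((‖kernel ω z‖⁻¹ : ℝ) : ℂ) • kernel ω z

/-- The Berezin transform `z ↦ ⟨T b_z, b_z⟩`; Mathlib's inner product is conjugate linear in its
first argument. -/
def berezin {ω : RadialWeight} (T : bergmanSpace ω →L[ℂ] bergmanSpace ω) (z : Disc) : ℂ :=
  inner ℂ (normalizedKernel ω z) (T (normalizedKernel ω z))

/-- The bounded operator `T` on `A²_ω` is the Toeplitz operator of the measure `μ`: for every `f`
and `z` the integral of `f(ζ) conj (B_z(ζ)) dμ(ζ)` converges absolutely and equals `(T f)(z)`. -/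
def IsToeplitz {ω : RadialWeight} (μ : Measure Disc)
    (T : bergmanSpace ω →L[ℂ] bergmanSpace ω) : Prop :=
  ∀ (f : bergmanSpace ω) (z : Disc),
    Integrable (fun ζ : Disc => f ζ * conj (kernel ω z ζ)) μ ∧
    T f z = ∫ ζ : Disc, f ζ * conj (kernel ω z ζ) ∂μ

/-- The `n`-th singular value of `T`: the distance from `T` to the bounded operators of rank at
most `n`. -/
def singularValue {H : Type*} [NormedAddCommGroup H] [InnerProductSpace ℂ H]
    (T : H →L[ℂ] H) (n : ℕ) : ℝ :=
  sInf {d : ℝ | ∃ R : H →L[ℂ] H, (R : H →ₗ[ℂ] H).rank ≤ (n : Cardinal) ∧ d = ‖T - R‖}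

/-- The Schatten class `S_p(H)` for `0 < p < ∞`. -/
def IsSchatten {H : Type*} [NormedAddCommGroup H] [InnerProductSpace ℂ H]
    (p : ℝ) (T : H →L[ℂ] H) : Prop :=
  IsCompactOperator T ∧ Summable fun n : ℕ => singularValue T n ^ p

/-- The measure `dA(z) / (1 - |z|)²` on the disc. -/
def hyperbolicArea : Measure Disc :=
  area.withDensity fun z => ENNReal.ofReal (1 / (1 - ‖(z : ℂ)‖) ^ 2)

end

end DoublingBergman

namespace DoublingBergman

open MeasureTheory Metric Set Filter Topology
open scoped ENNReal NNReal ComplexConjugate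

noncomputable section

/-! The counterexample is `μ = δ_0` with a weight whose tail decays only logarithmically. The
Toeplitz operator of a Dirac mass at `w` is `f ↦ ⟨f, B_w⟩ B_w` (`isToeplitz_dirac`). It has rank at
most one, hence is positive and trace class for every weight. Its Berezin transform is `|B_w(z)|² /
‖B_z‖²` (`berezin_rankOne_kernel`), so non-integrability needs an upper bound for `‖B_z‖`.

Cauchy's formula on circles near the boundary gives `‖B_z‖² ω̂((1+|z|)/2) ≤ 2/(1-|z|)`
(`norm_kernel_sq_mul_tail_le`). Hence the Berezin transform is at least `|B_w(z)|² (1-|z|)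
ω̂((1+|z|)/2) / 2`, and doubling replaces the tail by a multiple of `ω̂(|z|)`. Against
`dA/(1-|z|)²`, with `w = 0` and the mean value inequality for `|B_0|²` on circles, the integral
dominates a positive multiple of `|B_0(0)|² ∫ ω̂(r)/(1-r) dr` (`not_integrable_hyperbolicArea`).
Here `B_0(0) ≠ 0` because the constants belong to the space.

It remains to find a doubling weight for which this radial integral diverges. For `logWeight` one
has `ω̂(r) = 1/log(e/(1-r))`, and `ω̂(r)/(1-r)` is the derivative of `log log(e/(1-r))`, which is
unbounded (`lintegral_logWeight_tail_div`). -/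

/-! ### Polar coordinates and point evaluations -/

/-- Integration in polar coordinates with respect to normalized area on the disc. -/
lemma lintegral_area {g : ℂ → ℝ≥0∞} (hg : Measurable g) :
    ∫⁻ z : Disc, g z ∂area = ENNReal.ofReal Real.pi⁻¹ * ∫⁻ ρ in Ioo (0 : ℝ) 1, ENNReal.ofReal ρ *
      ∫⁻ θ in Ioo (-Real.pi) Real.pi, g (Complex.polarCoord.symm (ρ, θ)) := by
  rw [area, lintegral_smul_measure, smul_eq_mul]
  congr 1
  have h1 : ∫⁻ z : Disc, g z ∂(volume : Measure ℂ).comap Subtype.val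
      = ∫⁻ z in ball (0 : ℂ) 1, g z := lintegral_subtype_comap measurableSet_ball g
  rw [h1, ← lintegral_indicator measurableSet_ball, ← Complex.lintegral_comp_polarCoord_symm,
    polarCoord_target, Measure.volume_eq_prod, ← Measure.prod_restrict, lintegral_prod]
  rotate_left
  · apply Measurable.aemeasurable
    have : Measurable (fun p : ℝ × ℝ => Complex.polarCoord.symm p) := by
      simp only [Complex.polarCoord_symm_apply]; fun_prop
    exact (by fun_prop : Measurable fun p : ℝ × ℝ => ENNReal.ofReal p.1).smul
      ((hg.indicator measurableSet_ball).comp this)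
  rw [← lintegral_indicator measurableSet_Ioi, ← lintegral_indicator measurableSet_Ioo]
  refine lintegral_congr fun ρ => ?_
  by_cases h0 : 0 < ρ
  · rw [indicator_of_mem (mem_Ioi.2 h0)]
    have hn : ∀ θ : ℝ, ‖Complex.polarCoord.symm (ρ, θ)‖ = ρ := fun θ => by
      rw [Complex.norm_polarCoord_symm, abs_of_pos h0]
    by_cases h1 : ρ < 1
    · rw [indicator_of_mem (mem_Ioo.2 ⟨h0, h1⟩), ← lintegral_const_mul' _ _ ENNReal.ofReal_ne_top]
      refine lintegral_congr fun θ => ?_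
      rw [indicator_of_mem (by rw [mem_ball_zero_iff, hn]; exact h1), smul_eq_mul]
    · rw [indicator_of_notMem (fun h => h1 h.2)]
      simp only [smul_eq_mul]
      rw [← lintegral_zero (μ := volume.restrict (Ioo (-Real.pi) Real.pi))]
      refine lintegral_congr fun θ => ?_
      rw [indicator_of_notMem (by rw [mem_ball_zero_iff, hn]; exact h1), mul_zero]
  · rw [indicator_of_notMem (mt mem_Ioi.1 h0), indicator_of_notMem (fun h => h0 h.1)]

/-- An explicit bound for point evaluations in terms of the tail of the weight. -/
lemma enorm_sq_mul_tail_le (ω : RadialWeight) {F : ℂ → ℂ} (hF : DifferentiableOn ℂ F (ball 0 1))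
    {z : ℂ} (hz : ‖z‖ < 1) :
    ‖F z‖ₑ ^ 2 * ω.tail ((1 + ‖z‖) / 2) ≤
      ENNReal.ofReal (2 / (1 - ‖z‖)) * ∫⁻ w : Disc, ‖F w‖ₑ ^ 2 ∂ω.measure := by
  set r := ‖z‖ with hr
  have h0 : 0 ≤ r := norm_nonneg z
  set s := (1 + r) / 2 with hs
  have hπ := Real.pi_pos
  have h1r : 0 < 1 - r := by linarith
  set c := ENNReal.ofReal (Real.pi⁻¹ * s) with hc
  -- The numerator 2 compensates for the polar factor `s ≥ 1/2`.
  have hK : ENNReal.ofReal (1 / (Real.pi * (1 - r))) ≤ ENNReal.ofReal (2 / (1 - r)) * c := by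
    rw [hc, ← ENNReal.ofReal_mul (by positivity)]
    apply ENNReal.ofReal_le_ofReal
    have : 2 / (1 - r) * (Real.pi⁻¹ * s) = 1 / (Real.pi * (1 - r)) * (1 + r) := by
      rw [hs]; field_simp
    rw [this]
    exact le_mul_of_one_le_right (by positivity) (by linarith)
  rw [RadialWeight.tail, ← lintegral_const_mul' _ _ (by finiteness)]
  calc ∫⁻ ρ in Ioo s 1, ‖F z‖ₑ ^ 2 * ENNReal.ofReal (ω.toFun ρ)
      ≤ ∫⁻ ρ in Ioo s 1, ENNReal.ofReal (2 / (1 - r)) * (ENNReal.ofReal (ω.toFun ρ) * (c *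
          ∫⁻ θ in Ioo (-Real.pi) Real.pi, ‖F (Complex.polarCoord.symm (ρ, θ))‖ₑ ^ 2)) := by
        apply setLIntegral_mono' measurableSet_Ioo
        rintro ρ ⟨h2, h3⟩
        have := (enorm_sq_le_circle hF h0 hz h2 h3 le_rfl).trans (mul_le_mul_left hK _)
        calc _ ≤ (ENNReal.ofReal (2 / (1 - r)) * c * ∫⁻ θ in Ioo (-Real.pi) Real.pi,
              ‖F (Complex.polarCoord.symm (ρ, θ))‖ₑ ^ 2) * ENNReal.ofReal (ω.toFun ρ) := by
              gcongr
          _ = _ := by ring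
    _ = ENNReal.ofReal (2 / (1 - r)) * ∫⁻ ρ in Ioo s 1, (ENNReal.ofReal (ω.toFun ρ) * (c *
          ∫⁻ θ in Ioo (-Real.pi) Real.pi, ‖F (Complex.polarCoord.symm (ρ, θ))‖ₑ ^ 2)) := by
        rw [lintegral_const_mul' _ _ ENNReal.ofReal_ne_top]
    _ ≤ _ := by gcongr; exact ω.lintegral_measure hF (by positivity)

/-! ### Reproducing kernels, Dirac masses and rank one operators -/

lemma bergmanSpace.inner_eq {ω : RadialWeight} (f g : bergmanSpace ω) :
    inner ℂ f g = @inner ℂ _ InnerProductSpace.toInner f g := rfl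

lemma kernel_conj_symm (ω : RadialWeight) (w z : Disc) :
    conj (kernel ω w z) = kernel ω z w := by
  rw [← inner_kernel, ← inner_kernel, bergmanSpace.inner_eq, bergmanSpace.inner_eq,
    inner_conj_symm]

lemma kernel_self (ω : RadialWeight) (z : Disc) :
    kernel ω z z = ((‖kernel ω z‖ ^ 2 : ℝ) : ℂ) := by
  rw [← inner_kernel, bergmanSpace.inner_eq, inner_self_eq_norm_sq_to_K]
  push_cast
  rfl

/-- The norm of the reproducing kernel is controlled by the tail of the weight. -/
lemma norm_kernel_sq_mul_tail_le (ω : RadialWeight) (z : Disc) :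
    ENNReal.ofReal (‖kernel ω z‖ ^ 2) * ω.tail ((1 + ‖(z : ℂ)‖) / 2) ≤
      ENNReal.ofReal (2 / (1 - ‖(z : ℂ)‖)) := by
  rcases eq_or_ne (kernel ω z) 0 with h | h
  · simp [h]
  -- For `F = B_z` the value at `z` is `‖B_z‖²`, so the left side carries `‖B_z‖⁴` and the right
  -- side `‖B_z‖²`; one factor `‖B_z‖²` cancels.
  have key := enorm_sq_mul_tail_le ω (bergmanSpace.differentiableOn_rep (kernel ω z))
    (mem_ball_zero_iff.1 z.2)
  have e2 : ‖((kernel ω z : bergmanSpace ω) : Lp ℂ 2 ω.measure)‖ₑ ^ 2 =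
      ENNReal.ofReal (‖kernel ω z‖ ^ 2) := by
    rw [ENNReal.ofReal_pow (norm_nonneg _)]
    exact congrArg (· ^ 2)
      (ofReal_norm ((kernel ω z : bergmanSpace ω) : Lp ℂ 2 ω.measure)).symm
  have hpos : 0 < ‖kernel ω z‖ ^ 2 := by positivity
  rw [bergmanSpace.lintegral_eq _ (bergmanSpace.ae_eq_rep (kernel ω z)), e2,
    ← bergmanSpace.coe_apply, kernel_self, ← ofReal_norm, Complex.norm_real,
    Real.norm_of_nonneg hpos.le, sq (ENNReal.ofReal _), mul_right_comm] at key
  exact (ENNReal.mul_le_mul_iff_left (by simpa using h) ENNReal.ofReal_ne_top).1 key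

/-- With `y = B_z` and `c = ‖B_z‖⁻¹` this computes the Berezin transform of a rank one operator. -/
lemma inner_smul_rankOne_smul {H : Type*} [NormedAddCommGroup H] [InnerProductSpace ℂ H]
    (x y : H) (c : ℝ) :
    inner ℂ ((c : ℂ) • y) (InnerProductSpace.rankOne ℂ x x ((c : ℂ) • y)) =
      ((c ^ 2 * ‖(inner ℂ x y : ℂ)‖ ^ 2 : ℝ) : ℂ) := by
  rw [InnerProductSpace.rankOne_apply, inner_smul_right, inner_smul_left, inner_smul_right,
    Complex.conj_ofReal, ← inner_conj_symm y x]
  push_cast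
  rw [← Complex.mul_conj']
  ring

/-- The Berezin transform of the rank one operator `f ↦ ⟨f, B_w⟩ B_w`. -/
lemma berezin_rankOne_kernel (ω : RadialWeight) (w z : Disc) :
    berezin (InnerProductSpace.rankOne ℂ (kernel ω w) (kernel ω w)) z =
      ((‖kernel ω z‖⁻¹ ^ 2 * ‖kernel ω w z‖ ^ 2 : ℝ) : ℂ) := by
  have h : @inner ℂ _ InnerProductSpace.toInner (kernel ω w) (kernel ω z) =
      conj (kernel ω w z) := by
    rw [kernel_conj_symm]; exact inner_kernel ω w _
  have key := inner_smul_rankOne_smul (kernel ω w) (kernel ω z) ‖kernel ω z‖⁻¹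
  have hn : ‖@inner ℂ _ InnerProductSpace.toInner (kernel ω w) (kernel ω z)‖ = ‖kernel ω w z‖ := by
    rw [h]; exact RCLike.norm_conj _
  rw [hn] at key
  exact key

/-- The Toeplitz operator of the Dirac mass at `w` is `f ↦ ⟨f, B_w⟩ B_w`. -/
lemma isToeplitz_dirac (ω : RadialWeight) (w : Disc) :
    IsToeplitz (Measure.dirac w)
      (InnerProductSpace.rankOne ℂ (kernel ω w) (kernel ω w)) := by
  intro f z
  refine ⟨integrable_dirac (by finiteness), ?_⟩
  have h := (bergmanSpace.evalLM z).map_smul (@inner ℂ _ InnerProductSpace.toInner (kernel ω w) f) (kernel ω w)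
  have h' : @inner ℂ _ InnerProductSpace.toInner (kernel ω w) f = f w := inner_kernel ω w f
  have hR : ∫ ζ, f ζ * conj (kernel ω z ζ) ∂Measure.dirac w = f w * kernel ω w z :=
    (integral_dirac _ w).trans (congrArg (f w * ·) (kernel_conj_symm ω z w))
  exact h.trans ((congrArg (· * kernel ω w z) h').trans hR.symm)

/-- The operator factors through `ℂ`, hence is compact; it is its own best approximation of rank at
most `n` for each `n ≥ 1`, so only the singular value with index 0 can be nonzero. -/
lemma isSchatten_rankOne {H : Type*} [NormedAddCommGroup H] [InnerProductSpace ℂ H] (x y : H) :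
    IsSchatten 1 (InnerProductSpace.rankOne ℂ x y) := by
  constructor
  · exact (isCompactOperator_id.comp_clm (innerSL ℂ y) : IsCompactOperator _).clm_comp
      (ContinuousLinearMap.toSpanSingleton ℂ x)
  · have hrank : (InnerProductSpace.rankOne ℂ x y : H →ₗ[ℂ] H).rank ≤ 1 := by
      refine (Submodule.rank_mono (t := Submodule.span ℂ {x}) ?_).trans (rank_span_le _ |>.trans (by simp))
      rintro _ ⟨v, rfl⟩
      exact Submodule.smul_mem _ _ (Submodule.mem_span_singleton_self x)
    refine summable_of_ne_finset_zero (s := {0}) fun n hn => ?_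
    have hn1 : 1 ≤ n := Nat.one_le_iff_ne_zero.2 (by simpa using hn)
    have : singularValue (InnerProductSpace.rankOne ℂ x y) n = 0 := by
      refine IsLeast.csInf_eq ⟨⟨_, hrank.trans (by exact_mod_cast hn1), by simp⟩, ?_⟩
      rintro d ⟨R, -, rfl⟩
      exact norm_nonneg _
    rw [this, Real.rpow_one]

/-- The kernel at a point does not vanish at that point when the weight has finite mass. -/
lemma kernel_self_ne_zero (ω : RadialWeight) [IsFiniteMeasure ω.measure] (w : Disc) :
    kernel ω w w ≠ 0 := by
  -- If `B_w(w) = ‖B_w‖²` were zero, every element of the space would vanish at `w`; the constant 1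
  -- does not.
  let f : bergmanSpace ω := ⟨Lp.const 2 ω.measure (1 : ℂ), fun _ => 1,
    differentiableOn_const _, Lp.coeFn_const 2 ω.measure 1⟩
  have hf : f w = 1 := by
    rw [bergmanSpace.coe_apply]
    exact bergmanSpace.rep_eq f (F := fun _ => 1) (differentiableOn_const _)
      (Lp.coeFn_const 2 ω.measure 1) w
  intro h
  have h0 : kernel ω w = 0 := by
    rw [kernel_self] at h
    simpa using h
  rw [← inner_kernel, bergmanSpace.inner_eq, h0, inner_zero_left] at hf
  exact zero_ne_one hf

instance (ω : RadialWeight) : IsFiniteMeasure ω.measure := by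
  refine isFiniteMeasure_withDensity ?_
  have := ω.integrable.lintegral_lt_top
  exact this.ne

/-! ### The logarithmic weight -/

lemma tendsto_one_sub_log : Tendsto (fun x : ℝ => 1 - Real.log (1 - x)) (𝓝[<] 1) atTop := by
  have h2 : Tendsto (fun x : ℝ => 1 - x) (𝓝[<] 1) (𝓝[>] 0) := by
    apply tendsto_nhdsWithin_of_tendsto_nhds_of_eventually_within
    · have : Tendsto (fun x : ℝ => 1 - x) (𝓝 1) (𝓝 (1 - 1)) := by
        exact tendsto_const_nhds.sub tendsto_id
      rw [sub_self] at this
      exact this.mono_left nhdsWithin_le_nhds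
    · filter_upwards [self_mem_nhdsWithin] with x hx
      simpa using hx
  simpa [sub_eq_add_neg] using tendsto_atTop_add_const_left _ 1
    (tendsto_neg_atBot_atTop.comp (Real.tendsto_log_nhdsGT_zero.comp h2))

lemma one_sub_log_pos {r : ℝ} (h0 : 0 ≤ r) (h1 : r < 1) : 1 ≤ 1 - Real.log (1 - r) := by
  linarith [Real.log_nonpos (x := 1 - r) (by linarith) (by linarith)]

lemma hasDerivAt_one_sub_log {x : ℝ} (h1 : x < 1) :
    HasDerivAt (fun x : ℝ => 1 - Real.log (1 - x)) (1 / (1 - x)) x := by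
  have h := (((hasDerivAt_id x).const_sub 1).log (by simp; linarith)).const_sub 1
  exact h.congr_deriv (by simp [neg_div])

/-- The density `1 / ((1 - r) log(e / (1 - r))²)`. -/
def logDensity (r : ℝ) : ℝ := 1 / ((1 - r) * (1 - Real.log (1 - r)) ^ 2)

lemma measurable_logDensity : Measurable logDensity := by
  unfold logDensity; fun_prop

lemma logDensity_nonneg {r : ℝ} (h1 : r < 1) : 0 ≤ logDensity r := by
  have : 0 < 1 - r := by linarith
  unfold logDensity; positivity

/-- The density is the derivative of `-1/log(e/(1-x))`, which tends to 0 as `x → 1`. -/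
lemma lintegral_logDensity {r : ℝ} (h0 : 0 ≤ r) (h1 : r < 1) :
    ∫⁻ s in Ioo r 1, ENNReal.ofReal (logDensity s) =
      ENNReal.ofReal (1 - Real.log (1 - r))⁻¹ := by
  classical
  -- The cutoff gives the antiderivative its left limit 0 at `x = 1`; since `Real.log 0 = 0`, the
  -- bare formula would give `-1` there.
  set g : ℝ → ℝ := fun x => if x < 1 then -(1 - Real.log (1 - x))⁻¹ else 0 with hg
  have hder : ∀ x ∈ Ioo r 1, HasDerivAt g (logDensity x) x := by
    rintro x ⟨hx0, hx1⟩
    have hp := one_sub_log_pos (h0.trans hx0.le) hx1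
    have h := ((hasDerivAt_one_sub_log hx1).inv (by linarith)).neg
    have h' : HasDerivAt (fun x : ℝ => -(1 - Real.log (1 - x))⁻¹) (logDensity x) x := by
      refine h.congr_deriv ?_
      unfold logDensity
      have : 1 - x ≠ 0 := by linarith
      field_simp
    refine h'.congr_of_eventuallyEq ?_
    filter_upwards [Iio_mem_nhds hx1] with y hy
    simp only [hg, if_pos (mem_Iio.1 hy)]
  have hcont : ContinuousOn g (Icc r 1) := by
    rintro x ⟨hx0, hx1⟩
    rcases hx1.lt_or_eq with hx1 | rfl
    · have hp := one_sub_log_pos (h0.trans hx0) hx1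
      have h := ((hasDerivAt_one_sub_log hx1).inv (by linarith)).neg
      refine (h.continuousAt.congr ?_).continuousWithinAt
      filter_upwards [Iio_mem_nhds hx1] with y hy
      simp [hg, if_pos (mem_Iio.1 hy)]
    · have h3 : ContinuousWithinAt g (Iio 1) 1 := by
        have h4 : Tendsto (fun x : ℝ => -(1 - Real.log (1 - x))⁻¹) (𝓝[<] 1) (𝓝 (g 1)) := by
          have := (tendsto_inv_atTop_zero.comp tendsto_one_sub_log).neg
          simpa [hg, Function.comp_def] using this
        refine h4.congr' ?_
        filter_upwards [self_mem_nhdsWithin] with y hy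
        simp only [hg, if_pos (mem_Iio.1 hy)]
      exact (continuousWithinAt_insert_self.2 h3).mono fun y hy => by
        rcases hy.2.lt_or_eq with h | h
        · exact Or.inr h
        · exact Or.inl h
  have hnn : ∀ x ∈ Ioo r 1, 0 ≤ logDensity x := fun x hx => logDensity_nonneg hx.2
  -- Integrability up to the singular endpoint comes from the sign of the derivative and the
  -- continuity of `g` on the closed interval.
  have hint := intervalIntegral.integrableOn_deriv_of_nonneg hcont hder hnn
  have hval := intervalIntegral.integral_eq_sub_of_hasDerivAt_of_le h1.le hcont hder
    ((intervalIntegrable_iff_integrableOn_Ioc_of_le h1.le).2 hint)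
  rw [intervalIntegral.integral_of_le h1.le, integral_Ioc_eq_integral_Ioo] at hval
  rw [← ofReal_integral_eq_lintegral_ofReal (hint.mono_set Ioo_subset_Ioc_self)
    (by filter_upwards [ae_restrict_mem measurableSet_Ioo] with x hx using hnn x hx), hval]
  simp [hg, h1]

/-- The radial weight `ω(r) = 1 / ((1 - r) log(e / (1 - r))²)`. -/
def logWeight : RadialWeight where
  toFun := logDensity
  measurable_toFun := measurable_logDensity
  nonneg _ _ h := logDensity_nonneg h
  integrable := by
    refine ⟨(measurable_logDensity.comp (by fun_prop)).aestronglyMeasurable, ?_⟩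
    have hm := measurable_logDensity
    rw [hasFiniteIntegral_iff_enorm,
      lintegral_area (g := fun z : ℂ => ‖logDensity ‖z‖‖ₑ) (by fun_prop)]
    refine ENNReal.mul_lt_top ENNReal.ofReal_lt_top ?_
    calc _ ≤ ∫⁻ ρ in Ioo (0 : ℝ) 1, ENNReal.ofReal (2 * Real.pi) *
          ENNReal.ofReal (logDensity ρ) := by
          apply setLIntegral_mono' measurableSet_Ioo
          rintro ρ ⟨h0, h1⟩
          simp only [Complex.norm_polarCoord_symm, abs_of_pos h0, lintegral_const,
            Measure.restrict_apply MeasurableSet.univ, univ_inter, Real.volume_Ioo]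
          rw [Real.enorm_of_nonneg (logDensity_nonneg h1), mul_comm (ENNReal.ofReal (logDensity ρ))]
          have : Real.pi - -Real.pi = 2 * Real.pi := by ring
          rw [this]
          exact mul_le_of_le_one_left' (by simpa using h1.le)
      _ < ⊤ := by
          rw [lintegral_const_mul' _ _ ENNReal.ofReal_ne_top, lintegral_logDensity le_rfl zero_lt_one]
          exact ENNReal.mul_lt_top ENNReal.ofReal_lt_top ENNReal.ofReal_lt_top
  tail_pos r h0 h1 := by
    have := one_sub_log_pos h0 h1
    rw [lintegral_logDensity h0 h1, ENNReal.ofReal_pos]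
    positivity

lemma tail_logWeight {r : ℝ} (h0 : 0 ≤ r) (h1 : r < 1) :
    logWeight.tail r = ENNReal.ofReal (1 - Real.log (1 - r))⁻¹ :=
  lintegral_logDensity h0 h1

/-- Passing from `r` to `(1+r)/2` adds only `log 2 < 1` to `log(e/(1-r)) ≥ 1`, so the tail shrinks
by a factor of at most 2. -/
lemma isDoubling_logWeight : logWeight.IsDoubling := by
  refine ⟨2, fun r h0 h1 => ?_⟩
  have h2 : (0 : ℝ) ≤ (1 + r) / 2 := by linarith
  have h3 : (1 + r) / 2 < 1 := by linarith
  rw [tail_logWeight h0 h1, tail_logWeight h2 h3]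
  have e : ((2 : ℝ≥0) : ℝ≥0∞) = ENNReal.ofReal 2 := by simp
  rw [e, ← ENNReal.ofReal_mul (by norm_num)]
  apply ENNReal.ofReal_le_ofReal
  have ha := one_sub_log_pos h0 h1
  have hb := one_sub_log_pos h2 h3
  have hl : Real.log (1 - (1 + r) / 2) = Real.log (1 - r) - Real.log 2 := by
    rw [← Real.log_div (by linarith) (by norm_num)]
    congr 1; ring
  have := Real.log_two_lt_d9
  rw [inv_eq_one_div, ← div_eq_mul_inv, div_le_div_iff₀ (by linarith) (by linarith), hl]
  linarith

/-- The integrand is the derivative of `log log(e/(1-ρ))`, which tends to infinity at 1; a function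
with an integrable derivative could not do so. -/
lemma lintegral_logWeight_tail_div :
    ∫⁻ ρ in Ioo (1 / 2 : ℝ) 1, ENNReal.ofReal (1 / (1 - ρ)) * logWeight.tail ρ = ⊤ := by
  set g : ℝ → ℝ := fun x => 1 / (1 - x) * (1 - Real.log (1 - x))⁻¹ with hg
  have hev : ∀ᶠ x : ℝ in 𝓝[<] 1, x ∈ Ioo (1 / 2 : ℝ) 1 :=
    Ioo_mem_nhdsLT (by norm_num)
  have hd : ∀ x ∈ Ioo (1 / 2 : ℝ) 1,
      HasDerivAt (fun x => Real.log (1 - Real.log (1 - x))) (g x) x := by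
    rintro x ⟨h0, h1⟩
    have := one_sub_log_pos (by linarith) h1
    exact (hasDerivAt_one_sub_log h1).log (by linarith)
  have hni : ¬ IntegrableOn g (Ioo (1 / 2) 1) := by
    refine not_integrableOn_of_tendsto_norm_atTop_of_deriv_isBigO_filter (𝓝[<] (1 : ℝ)) hev
      (f := fun x => Real.log (1 - Real.log (1 - x)))
      (hev.mono fun x hx => (hd x hx).differentiableAt)
      (tendsto_norm_atTop_atTop.comp (Real.tendsto_log_atTop.comp tendsto_one_sub_log)) ?_
    have heq : deriv (fun x => Real.log (1 - Real.log (1 - x))) =ᶠ[𝓝[<] 1] g :=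
      hev.mono fun x hx => (hd x hx).deriv
    exact heq.trans_isBigO (Asymptotics.isBigO_refl g _)
  have hgm : Measurable g := by fun_prop
  have h1 : ∫⁻ ρ in Ioo (1 / 2 : ℝ) 1, ENNReal.ofReal (1 / (1 - ρ)) * logWeight.tail ρ =
      ∫⁻ ρ in Ioo (1 / 2 : ℝ) 1, ‖g ρ‖ₑ := by
    refine setLIntegral_congr_fun measurableSet_Ioo fun ρ hρ => ?_
    have := one_sub_log_pos (by linarith [hρ.1]) hρ.2
    have h2 : 0 < 1 - ρ := by linarith [hρ.2]
    simp only [hg]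
    rw [tail_logWeight (by linarith [hρ.1]) hρ.2, Real.enorm_of_nonneg (by positivity),
      ENNReal.ofReal_mul (by positivity)]
  by_contra h
  rw [h1] at h
  exact hni ⟨hgm.aestronglyMeasurable, lt_top_iff_ne_top.2 h⟩

/-! ### Lower bound for the Berezin transform and divergence of its integral -/

/-- Turns the kernel estimate into a lower bound for `|c|²/n²`, with `n = ‖B_z‖`, `c = B_w(z)`, `t =
1-|z|` and `A` the tail. When `n = 0` the convention `0⁻¹ = 0` makes the right side zero, hence the
condition on `c`. -/
lemma enorm_sq_mul_le_of_mul_le {c : ℂ} {n t : ℝ} {A : ℝ≥0∞} (ht : 0 < t) (hn : n = 0 → c = 0)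
    (h : ENNReal.ofReal (n ^ 2) * A ≤ ENNReal.ofReal (2 / t)) :
    ‖c‖ₑ ^ 2 * (ENNReal.ofReal (t / 2) * A) ≤ ‖((n⁻¹ ^ 2 * ‖c‖ ^ 2 : ℝ) : ℂ)‖ₑ := by
  rcases eq_or_ne n 0 with h0 | h0
  · simp [hn h0]
  have hpos : 0 < n ^ 2 := by positivity
  rw [← ofReal_norm, ← ofReal_norm, Complex.norm_real,
    Real.norm_of_nonneg (by positivity), mul_comm (_ ^ 2 : ℝ),
    ENNReal.ofReal_mul (by positivity), ENNReal.ofReal_pow (norm_nonneg _)]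
  gcongr
  have h2 : ENNReal.ofReal (t / 2) * ENNReal.ofReal (2 / t) = 1 := by
    rw [← ENNReal.ofReal_mul (by positivity), ← ENNReal.ofReal_one]
    congr 1; field_simp
  rw [inv_pow, ENNReal.ofReal_inv_of_pos hpos]
  refine ENNReal.le_inv_iff_mul_le.2 ?_
  calc _ = ENNReal.ofReal (t / 2) * (ENNReal.ofReal (n ^ 2) * A) := by ring
    _ ≤ _ := by rw [← h2]; gcongr

/-- A lower bound for the Berezin transform of `f ↦ ⟨f, B_w⟩ B_w`. -/
lemma le_enorm_berezin_rankOne_kernel (ω : RadialWeight) (w z : Disc) :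
    ‖kernel ω w z‖ₑ ^ 2 * (ENNReal.ofReal ((1 - ‖(z : ℂ)‖) / 2) *
      ω.tail ((1 + ‖(z : ℂ)‖) / 2)) ≤
      ‖berezin (InnerProductSpace.rankOne ℂ (kernel ω w) (kernel ω w)) z‖ₑ := by
  have hr : 0 < 1 - ‖(z : ℂ)‖ := by linarith [mem_ball_zero_iff.1 z.2]
  have h0 : ‖kernel ω z‖ = 0 → kernel ω w z = 0 := fun h => by
    have h' : kernel ω z = 0 := norm_eq_zero.1 h
    rw [← inner_kernel, bergmanSpace.inner_eq, h', inner_zero_left]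
  exact (enorm_sq_mul_le_of_mul_le hr h0 (norm_kernel_sq_mul_tail_le ω z)).trans_eq
    (congrArg enorm (berezin_rankOne_kernel ω w z).symm)

lemma RadialWeight.measurable_tail (ω : RadialWeight) : Measurable ω.tail :=
  Antitone.measurable fun _ _ h => lintegral_mono_set (Ioo_subset_Ioo_left h)

/-- The disc integral of `|F|²` against a radial function dominates the radial integral times
`|F(0)|²`. -/
lemma enorm_sq_mul_lintegral_le {F : ℂ → ℂ} (hF : DifferentiableOn ℂ F (ball 0 1))
    {k : ℝ → ℝ≥0∞} (hk : Measurable k) :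
    ‖F 0‖ₑ ^ 2 * (ENNReal.ofReal (1 / 2) * ∫⁻ ρ in Ioo (1 / 2 : ℝ) 1, k ρ) ≤
      ∫⁻ z : Disc, ‖F z‖ₑ ^ 2 * k ‖(z : ℂ)‖ ∂area := by
  classical
  set G : ℂ → ℂ := (ball (0 : ℂ) 1).piecewise F 0 with hG
  have hGm : Measurable G := by
    apply ContinuousOn.measurable_piecewise hF.continuousOn continuousOn_const measurableSet_ball
  have h1 : ∀ z : Disc, F z = G z := fun z => by simp [hG, z.2]
  simp_rw [h1]
  rw [lintegral_area (g := fun z : ℂ => ‖G z‖ₑ ^ 2 * k ‖z‖) (by fun_prop), ← mul_assoc,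
    ← lintegral_const_mul' _ _ (by finiteness), ← lintegral_const_mul' _ _ (by finiteness)]
  -- The circle estimate at the centre is available only for radii `ρ > 1/2`; these also give the
  -- lower bound `1/2` for the polar factor `ρ`.
  refine le_trans ?_ (lintegral_mono_set (Ioo_subset_Ioo_left (by norm_num : (0 : ℝ) ≤ 1 / 2)))
  apply setLIntegral_mono' measurableSet_Ioo
  rintro ρ ⟨h2, h3⟩
  have hρ : 0 < ρ := by linarith
  have hn : ∀ θ : ℝ, ‖Complex.polarCoord.symm (ρ, θ)‖ = ρ := fun θ => by
    rw [Complex.norm_polarCoord_symm, abs_of_pos hρ]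
  have hGF : ∀ θ : ℝ, G (Complex.polarCoord.symm (ρ, θ)) = F (Complex.polarCoord.symm (ρ, θ)) :=
    fun θ => Set.piecewise_eq_of_mem _ _ _ (by rw [mem_ball_zero_iff, hn]; exact h3)
  simp_rw [hn, hGF]
  rw [lintegral_mul_const'' _ (by
    have hm : Measurable fun θ : ℝ => ‖G (Complex.polarCoord.symm (ρ, θ))‖ₑ ^ 2 := by
      simp only [Complex.polarCoord_symm_apply]; fun_prop
    simp_rw [hGF] at hm
    exact hm.aemeasurable)]
  -- At the centre the constant in the circle estimate is `1/π`, exactly the normalization of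
  -- `area`.
  have hc := enorm_sq_le_circle hF le_rfl zero_lt_one (by simpa using h2) h3 (z := 0) (by simp)
  rw [sub_zero, mul_one, one_div] at hc
  calc _ ≤ ENNReal.ofReal Real.pi⁻¹ * (∫⁻ θ in Ioo (-Real.pi) Real.pi,
        ‖F (Complex.polarCoord.symm (ρ, θ))‖ₑ ^ 2) * ENNReal.ofReal ρ * k ρ := by
        gcongr
    _ = _ := by ring

/-- If `ω ∈ D̂` and `∫ ω̂(r) / (1 - r) dr` diverges at `1`, then a function bounded below by
`|F(z)|² (1 - |z|) ω̂((1 + |z|) / 2)` with `F` analytic and `F(0) ≠ 0` is not integrable with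
respect to `dA / (1 - |z|)²`. -/
lemma not_integrable_hyperbolicArea {ω : RadialWeight} (hω : ω.IsDoubling)
    (hdiv : ∫⁻ ρ in Ioo (1 / 2 : ℝ) 1, ENNReal.ofReal (1 / (1 - ρ)) * ω.tail ρ = ⊤)
    {F : ℂ → ℂ} (hF : DifferentiableOn ℂ F (ball 0 1)) (hF0 : F 0 ≠ 0) {b : Disc → ℂ}
    (hb : ∀ z : Disc, ‖F z‖ₑ ^ 2 * (ENNReal.ofReal ((1 - ‖(z : ℂ)‖) / 2) *
      ω.tail ((1 + ‖(z : ℂ)‖) / 2)) ≤ ‖b z‖ₑ) :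
    ¬ Integrable b hyperbolicArea := by
  intro hint
  obtain ⟨C, hC⟩ := hω
  have hfin := hasFiniteIntegral_iff_enorm.1 hint.2
  have htm := ω.measurable_tail
  -- This is `(1-ρ)/2 · ω̂(ρ)` divided by `(1-ρ)²`: the radial part of the lower bound after
  -- doubling, with the density of `hyperbolicArea` included.
  set k : ℝ → ℝ≥0∞ := fun ρ => ENNReal.ofReal (1 / 2) *
    (ENNReal.ofReal (1 / (1 - ρ)) * ω.tail ρ) with hk
  have hkm : Measurable k := by fun_prop
  have hlow := enorm_sq_mul_lintegral_le hF hkm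
  have hupp : ∫⁻ z : Disc, ‖F z‖ₑ ^ 2 * k ‖(z : ℂ)‖ ∂area ≤
      C * ∫⁻ z, ‖b z‖ₑ ∂hyperbolicArea := by
    rw [hyperbolicArea, lintegral_withDensity_eq_lintegral_mul_non_measurable _ (by fun_prop)
      (ae_of_all _ fun z => ENNReal.ofReal_lt_top), ← lintegral_const_mul' _ _ ENNReal.coe_ne_top]
    refine lintegral_mono fun z => ?_
    set r := ‖(z : ℂ)‖ with hr
    have hr1 : r < 1 := mem_ball_zero_iff.1 z.2
    have hpos : 0 < 1 - r := by linarith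
    have h1 : ENNReal.ofReal (1 / 2) * ENNReal.ofReal (1 / (1 - r)) =
        ENNReal.ofReal (1 / (1 - r) ^ 2) * ENNReal.ofReal ((1 - r) / 2) := by
      rw [← ENNReal.ofReal_mul (by positivity), ← ENNReal.ofReal_mul (by positivity)]
      congr 1; field_simp
    calc ‖F z‖ₑ ^ 2 * k r = ENNReal.ofReal (1 / (1 - r) ^ 2) *
          (‖F z‖ₑ ^ 2 * (ENNReal.ofReal ((1 - r) / 2) * ω.tail r)) := by
          rw [hk]; simp only []; rw [← mul_assoc (ENNReal.ofReal (1 / 2)), h1]; ring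
      _ ≤ ENNReal.ofReal (1 / (1 - r) ^ 2) *
          (‖F z‖ₑ ^ 2 * (ENNReal.ofReal ((1 - r) / 2) * (C * ω.tail ((1 + r) / 2)))) := by
          gcongr
          -- Doubling passes from the tail at `r`, whose integral diverges by assumption, to the
          -- tail at `(1+r)/2` in the bound for `b`.
          exact hC r (norm_nonneg _) hr1
      _ = C * (ENNReal.ofReal (1 / (1 - r) ^ 2) *
          (‖F z‖ₑ ^ 2 * (ENNReal.ofReal ((1 - r) / 2) * ω.tail ((1 + r) / 2)))) := by ring
      _ ≤ _ := by
          simp only [Pi.mul_apply]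
          gcongr
          exact hb z
  have htop : ‖F 0‖ₑ ^ 2 * (ENNReal.ofReal (1 / 2) * ∫⁻ ρ in Ioo (1 / 2 : ℝ) 1, k ρ) = ⊤ := by
    rw [hk, lintegral_const_mul' _ _ ENNReal.ofReal_ne_top, hdiv]
    have h2 : ENNReal.ofReal (1 / 2) ≠ 0 := by simp
    rw [ENNReal.mul_top h2, ENNReal.mul_top h2, ENNReal.mul_top (by simpa using hF0)]
  rw [htop] at hlow
  exact (ENNReal.mul_lt_top ENNReal.coe_lt_top hfin).ne (top_le_iff.1 (hlow.trans hupp))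

/-- If `ω ∈ D̂` and `∫ ω̂(r) / (1 - r) dr` diverges at `1`, then the Berezin transform of
`f ↦ ⟨f, B_0⟩ B_0` is not integrable with respect to `dA / (1 - |z|)²`. -/
lemma not_integrable_berezin_rankOne_kernel {ω : RadialWeight} (hω : ω.IsDoubling)
    (hdiv : ∫⁻ ρ in Ioo (1 / 2 : ℝ) 1, ENNReal.ofReal (1 / (1 - ρ)) * ω.tail ρ = ⊤) (w : Disc)
    (hw : (w : ℂ) = 0) :
    ¬ Integrable (berezin (InnerProductSpace.rankOne ℂ (kernel ω w) (kernel ω w)))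
      hyperbolicArea :=
  not_integrable_hyperbolicArea hω hdiv (bergmanSpace.differentiableOn_rep (kernel ω w))
    (fun h => kernel_self_ne_zero ω w ((congrArg (bergmanSpace.rep (kernel ω w)) hw).trans h))
    (le_enorm_berezin_rankOne_kernel ω w)

end

end DoublingBergman

theorem mainTheorem10 :
    (∃ (ω : DoublingBergman.RadialWeight)
        (μ : MeasureTheory.Measure DoublingBergman.Disc)
        (T : DoublingBergman.bergmanSpace ω →L[ℂ] DoublingBergman.bergmanSpace ω),
      ω.IsDoubling ∧ DoublingBergman.IsToeplitz μ T ∧ DoublingBergman.IsSchatten 1 T ∧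
        ¬ MeasureTheory.Integrable (DoublingBergman.berezin T) DoublingBergman.hyperbolicArea) ∧
    ¬ (∀ ω : DoublingBergman.RadialWeight, ω.IsDoubling →
        ∀ T : DoublingBergman.bergmanSpace ω →L[ℂ] DoublingBergman.bergmanSpace ω,
          T.IsPositive →
            (DoublingBergman.IsSchatten 1 T ↔
              MeasureTheory.Integrable (DoublingBergman.berezin T)
                DoublingBergman.hyperbolicArea)) := by
  let w : DoublingBergman.Disc := ⟨0, Metric.mem_ball_self zero_lt_one⟩
  have hS := DoublingBergman.isSchatten_rankOne (DoublingBergman.kernel DoublingBergman.logWeight w)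
    (DoublingBergman.kernel DoublingBergman.logWeight w)
  have hI := DoublingBergman.not_integrable_berezin_rankOne_kernel
    DoublingBergman.isDoubling_logWeight DoublingBergman.lintegral_logWeight_tail_div w rfl
  refine ⟨⟨DoublingBergman.logWeight, _, _, DoublingBergman.isDoubling_logWeight,
    DoublingBergman.isToeplitz_dirac _ w, hS, hI⟩, fun h => hI ?_⟩
  -- The same operator refutes the equivalence: it is positive and trace class, so the equivalence
  -- would make its Berezin transform integrable.
  exact (h _ DoublingBergman.isDoubling_logWeight _
    (InnerProductSpace.isPositive_rankOne_self _)).1 hS
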